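/- Let $Q$ be a smooth finite-dimensional manifold (without boundary). A discretization map on $Q$ is a smooth map $R_d=(R^1,R^2):U\to Q\times Q$, defined on an open neighbourhood $U\subset TQ$ of the zero section, such that $R_d(0_q)=(q,q)$ and $T_{0_q}(R^2|_{T_qQ})-T_{0_q}(R^1|_{T_qQ})=\mathrm{id}_{T_qQ}$ for all $q\in Q$. Its cotangent lift is $$R_d^{T^*}=\Phi^{-1}\circ\widehat{R_d}\circ\alpha_Q ,$$ with values in $T^*Q\times T^*Q$, where $\alpha_Q:TT^*Q\to T^*TQ$ is the canonical isomorphism, $(q,p,\dot q,\dot p)\mapsto(q,\dot q,\dot p,p)$ in natural coordinates; $\widehat{R_d}(\beta_x)=\beta_x\circ(T_xR_d)^{-1}\in T^*_{R_d(x)}(Q\times Q)$ for $\beta_x\in T_x^*TQ$; and $\Phi:T^*Q\times T^*Q\to T^*(Q\times Q)$, $(q_0,p_0;q_1,p_1)\mapsto(q_0,q_1,-p_0,p_1)$. It is defined at those $w\in TT^*Q$ for which $x=T\pi_Q(w)$ lies in $U$ and $T_xR_d$ is invertible, where $\pi_Q:T^*Q\to Q$ is the projection. Let $H:T^*Q\to\mathbb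 R$ be smooth, with Hamiltonian vector field $X_H$ given by $i_{X_H}\omega_Q=dH$, where $\omega_Q=-d\theta_Q$ is the canonical symplectic form. For $h\in\mathbb R$ put $$\mathcal L^h=\{(\alpha,\beta)\in T^*Q\times T^*Q \mid \exists\,\gamma\in T^*Q:\ h X_H(\gamma)\in\operatorname{dom}R_d^{T^*}\ \text{and}\ (\alpha,\beta)=R_d^{T^*}(h X_H(\gamma))\},$$ and, for $\mathcal L\subset T^*Q\times T^*Q$, let $\mathcal L^\dagger=\{(\alpha,\beta)\mid(\beta,\alpha)\in\mathcal L\}$. Let $\iota(q,q')=(q',q)$ on $Q\times Q$. If for every $v_q\in U$ one has $-v_q\in U$ and $R_d(v_q)=\iota(R_d(-v_q))$, then the method defined by $\mathcal L^h$ is symmetric: $(\mathcal L^h)^\dagger=\mathcal L^{-h}$ for every $h\in\mathbb R$. -/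

import Mathlib

open scoped Manifold ContDiff Topology
open Bundle Set

noncomputable section

section General

variable {E : Type*} [NormedAddCommGroup E] [NormedSpace ℝ E]
  {H : Type*} [TopologicalSpace H] (I : ModelWithCorners ℝ E H)
  {E' : Type*} [NormedAddCommGroup E'] [NormedSpace ℝ E']
  {H' : Type*} [TopologicalSpace H'] (I' : ModelWithCorners ℝ E' H')

/-- The model with corners of the cotangent bundle. -/
abbrev ModelWithCorners.cotangent : ModelWithCorners ℝ (E × (E →L[ℝ] ℝ)) (ModelProd H (E →L[ℝ] ℝ)) :=
  I.prod 𝓘(ℝ, E →L[ℝ] ℝ)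

/-- The cotangent bundle `T^*M`: the bundle of continuous linear forms on the tangent spaces, with
Mathlib's topology and smooth structure of a hom bundle. -/
abbrev CotangentBundle (M : Type*) [TopologicalSpace M] [ChartedSpace H M] :=
  TotalSpace (E →L[ℝ] ℝ) (fun x : M => TangentSpace I x →L[ℝ] ℝ)

variable {M : Type*} [TopologicalSpace M] [ChartedSpace H M]
  {N : Type*} [TopologicalSpace N] [ChartedSpace H' N]

/-- Fibrewise multiplication by `c` in a tangent bundle, `v_x ↦ c v_x`. -/
def TangentBundle.smulFiber (c : ℝ) (v : TangentBundle I M) : TangentBundle I M :=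
  ⟨v.proj, c • v.snd⟩

/-- Fibrewise negation in a tangent bundle, `v_x ↦ - v_x`. -/
def TangentBundle.negFiber (v : TangentBundle I M) : TangentBundle I M :=
  ⟨v.proj, -v.snd⟩

/-- `R : U ⊆ TM → M × M` is a discretization map: it is defined and smooth on the open neighbourhood
`U` of the zero section, `R (0_x) = (x, x)`, and `T_{0_x} R²_x - T_{0_x} R¹_x = id` on `T_x M`, where
`R^a_x` is the restriction of the `a`-th component of `R` to `T_x M` (whose model space is `E`).
The values of `R` outside `U` are irrelevant. -/
structure IsDiscretizationMap [IsManifold I 1 M] (U : Set (TangentBundle I M))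
    (R : TangentBundle I M → M × M) : Prop where
  isOpen : IsOpen U
  zero_mem : ∀ x : M, (⟨x, 0⟩ : TangentBundle I M) ∈ U
  contMDiffOn : ContMDiffOn I.tangent (I.prod I) ∞ R U
  map_zero : ∀ x : M, R ⟨x, 0⟩ = (x, x)
  deriv_sub : ∀ x : M,
    let D₁ : E →L[ℝ] E := mfderiv 𝓘(ℝ, E) I (fun v : E => (R ⟨x, v⟩).1) 0
    let D₂ : E →L[ℝ] E := mfderiv 𝓘(ℝ, E) I (fun v : E => (R ⟨x, v⟩).2) 0
    D₂ - D₁ = ContinuousLinearMap.id ℝ E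

/-- The cotangent lift `F̂ = T^*F⁻¹ : T^*M → T^*N` of (the inverse of) a local diffeomorphism `F`:
`F̂ (α_x) = α_x ∘ (T_x F)⁻¹ ∈ T^*_{F x} N`. It is meaningful at the covectors `α_x` for which
`T_x F` is invertible. -/
def cotangentLift (F : M → N) (a : CotangentBundle I M) : CotangentBundle I' N :=
  ⟨F a.proj, a.snd.comp (mfderiv I I' F a.proj).inverse⟩

/-- The exterior derivative at `x` of the one-form `θ` on `M`, as a bilinear form on `T_x M`.
In the chart `φ` at `x`, the form is `Θ y = θ (φ⁻¹ y) ∘ T_y φ⁻¹`, whose exterior derivative at `φ x`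
is `(u, v) ↦ D Θ u v - D Θ v u`; this is pulled back to `T_x M` along `T_x φ`. -/
def oneFormExtDeriv (θ : ∀ x : M, TangentSpace I x →L[ℝ] ℝ) (x : M) :
    TangentSpace I x →L[ℝ] TangentSpace I x →L[ℝ] ℝ :=
  let Θ : E → E →L[ℝ] ℝ := fun y =>
    (θ ((extChartAt I x).symm y)).comp
      (mfderivWithin 𝓘(ℝ, E) I (extChartAt I x).symm (range I) y)
  let D : E →L[ℝ] E →L[ℝ] ℝ := fderivWithin ℝ Θ (range I) (extChartAt I x x)
  let A : E →L[ℝ] E := mfderiv I 𝓘(ℝ, E) (extChartAt I x) x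
  let B : E →L[ℝ] E →L[ℝ] ℝ := (D - D.flip).bilinearComp A A
  B

variable [IsManifold I 1 M]

/-- The Liouville one-form on `T^*M`: `⟨θ(α), X⟩ = ⟨α, Tπ(X)⟩`. -/
def liouvilleForm (a : CotangentBundle I M) :
    TangentSpace I.cotangent a →L[ℝ] ℝ :=
  a.snd.comp (mfderiv I.cotangent I
    (fun b : CotangentBundle I M => b.proj) a)

/-- The canonical symplectic form `ω = -dθ` of `T^*M`, in the form of the musical map
`ω^♭ : X ↦ i_X ω`. -/
def symplecticForm (a : CotangentBundle I M) :
    TangentSpace I.cotangent a →L[ℝ]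
      TangentSpace I.cotangent a →L[ℝ] ℝ :=
  -oneFormExtDeriv I.cotangent (liouvilleForm I) a

/-- The Hamiltonian vector field `X_H = ω^♯ (dH)`, where `ω^♯ = (ω^♭)⁻¹`; equivalently
`i_{X_H} ω = dH`. -/
def hamiltonianVectorField (Ham : CotangentBundle I M → ℝ) (a : CotangentBundle I M) :
    TangentSpace I.cotangent a :=
  (symplecticForm I a).inverse (mfderiv I.cotangent 𝓘(ℝ, ℝ) Ham a)

end General

section SymplecticForm

/- The canonical symplectic form is `dq ∧ dp` and it is nondegenerate, so that the inverse in the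
definition of `hamiltonianVectorField` is a genuine one and `i_{X_H} ω = dH` holds. -/

variable {E : Type*} [NormedAddCommGroup E] [NormedSpace ℝ E]
  {Q : Type*} [TopologicalSpace Q] [ChartedSpace E Q] [IsManifold 𝓘(ℝ, E) ∞ Q]


/-- In the natural chart at `a₀` the Liouville form is `p dq`. -/
theorem liouvilleForm_chart (a₀ : CotangentBundle 𝓘(ℝ, E) Q) (y : E × (E →L[ℝ] ℝ))
    (hy : y ∈ (extChartAt 𝓘(ℝ, E).cotangent a₀).target) (u : E × (E →L[ℝ] ℝ)) :
    liouvilleForm 𝓘(ℝ, E) ((extChartAt 𝓘(ℝ, E).cotangent a₀).symm y)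
      (mfderivWithin 𝓘(ℝ, E × (E →L[ℝ] ℝ)) 𝓘(ℝ, E).cotangent (extChartAt 𝓘(ℝ, E).cotangent a₀).symm (range 𝓘(ℝ, E).cotangent) y u) = y.2 u.1 := by
  set b := (extChartAt 𝓘(ℝ, E).cotangent a₀).symm y with hb
  have hrange : range 𝓘(ℝ, E).cotangent = univ := by simp
  have hy1 : y.1 ∈ (extChartAt 𝓘(ℝ, E) a₀.proj).target := by
    rw [FiberBundle.extChartAt_target] at hy; exact hy.1.1
  have hproj : ∀ z ∈ (extChartAt 𝓘(ℝ, E).cotangent a₀).target, ((extChartAt 𝓘(ℝ, E).cotangent a₀).symm z).proj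
      = (extChartAt 𝓘(ℝ, E) a₀.proj).symm z.1 := by
    intro z hz
    rw [FiberBundle.extChartAt_target] at hz
    rw [FiberBundle.extChartAt]
    exact (trivializationAt (E →L[ℝ] ℝ)
      (fun x : Q => TangentSpace 𝓘(ℝ, E) x →L[ℝ] ℝ) a₀.proj).proj_symm_apply'
        (b := (extChartAt 𝓘(ℝ, E) a₀.proj).symm z.1) (x := z.2) hz.1.2
  have hbsrc : b.proj ∈ (chartAt E a₀.proj).source := by
    rw [hproj y hy]
    have := (extChartAt 𝓘(ℝ, E) a₀.proj).map_target hy1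
    simpa using this
  have hcoord : (trivializationAt (E →L[ℝ] ℝ) (fun x : Q => TangentSpace 𝓘(ℝ, E) x →L[ℝ] ℝ) a₀.proj b).2 = y.2 := by
    have h := (extChartAt 𝓘(ℝ, E).cotangent a₀).right_inv hy
    rw [← hb, FiberBundle.extChartAt] at h
    exact congrArg Prod.snd h
  rw [hom_trivializationAt_apply] at hcoord
  have hs := TangentBundle.symmL_trivializationAt (𝕜 := ℝ) (I := 𝓘(ℝ, E)) (x₀ := a₀.proj) (x := b.proj) hbsrc
  have hcomp : (mfderiv 𝓘(ℝ, E).cotangent 𝓘(ℝ, E) (fun b : CotangentBundle 𝓘(ℝ, E) Q => b.proj) b)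
      (mfderivWithin 𝓘(ℝ, E × (E →L[ℝ] ℝ)) 𝓘(ℝ, E).cotangent (extChartAt 𝓘(ℝ, E).cotangent a₀).symm (range 𝓘(ℝ, E).cotangent) y u)
      = mfderivWithin 𝓘(ℝ, E) 𝓘(ℝ, E) (extChartAt 𝓘(ℝ, E) a₀.proj).symm (range 𝓘(ℝ, E)) y.1 u.1 := by
    have hd : MDifferentiableWithinAt 𝓘(ℝ, E × (E →L[ℝ] ℝ)) 𝓘(ℝ, E).cotangent
        (extChartAt 𝓘(ℝ, E).cotangent a₀).symm (range 𝓘(ℝ, E).cotangent) y :=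
      mdifferentiableWithinAt_extChartAt_symm hy
    have hp : MDifferentiableAt 𝓘(ℝ, E).cotangent 𝓘(ℝ, E)
        (fun b : CotangentBundle 𝓘(ℝ, E) Q => b.proj) b := mdifferentiableAt_proj _
    have hd' : MDifferentiableWithinAt 𝓘(ℝ, E) 𝓘(ℝ, E)
        (extChartAt 𝓘(ℝ, E) a₀.proj).symm (range 𝓘(ℝ, E)) y.1 :=
      mdifferentiableWithinAt_extChartAt_symm hy1
    rw [hrange] at hd ⊢
    have hr' : range 𝓘(ℝ, E) = univ := by simp
    rw [hr'] at hd' ⊢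
    rw [mfderivWithin_univ, mfderivWithin_univ]
    rw [mdifferentiableWithinAt_univ] at hd hd'
    have e1 := mfderiv_comp_apply y hp hd u
    refine e1.symm.trans ?_
    have hev : ((fun b : CotangentBundle 𝓘(ℝ, E) Q => b.proj) ∘ (extChartAt 𝓘(ℝ, E).cotangent a₀).symm)
        =ᶠ[𝓝 y] (extChartAt 𝓘(ℝ, E) a₀.proj).symm ∘ Prod.fst := by
      have : (extChartAt 𝓘(ℝ, E).cotangent a₀).target ∈ 𝓝 y :=
        extChartAt_target_mem_nhds' hy
      filter_upwards [this] with z hz using hproj z hz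
    have e2 := hev.mfderiv_eq (I := 𝓘(ℝ, E × (E →L[ℝ] ℝ))) (I' := 𝓘(ℝ, E))
    have e3 := congrArg (fun L => (L u : E)) e2
    refine e3.trans ?_
    have hf : MDifferentiableAt 𝓘(ℝ, E × (E →L[ℝ] ℝ)) 𝓘(ℝ, E) (Prod.fst : E × (E →L[ℝ] ℝ) → E) y :=
      mdifferentiableAt_iff_differentiableAt.2 differentiableAt_fst
    have e4 := mfderiv_comp_apply y (g := (extChartAt 𝓘(ℝ, E) a₀.proj).symm) hd' hf u
    refine e4.trans ?_
    rw [mfderiv_eq_fderiv, fderiv_fst]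
    rfl
  rw [liouvilleForm]
  change b.snd _ = _
  rw [← hcoord]
  refine (congrArg b.snd hcomp).trans ?_
  have hpe : extChartAt 𝓘(ℝ, E) a₀.proj b.proj = y.1 := by
    rw [hproj y hy]; exact (extChartAt 𝓘(ℝ, E) a₀.proj).right_inv hy1
  rw [hpe] at hs
  rw [ContinuousLinearMap.inCoordinates, hs]
  simp
  rfl


theorem oneFormExtDeriv_apply_of_eventually {V : Type*} [NormedAddCommGroup V] [NormedSpace ℝ V]
    {K : Type*} [TopologicalSpace K] (I : ModelWithCorners ℝ V K) (hI : range I = univ)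
    {M : Type*} [TopologicalSpace M] [ChartedSpace K M] [IsManifold I 1 M]
    (θ : ∀ x : M, TangentSpace I x →L[ℝ] ℝ) (x : M) (Λ : V →L[ℝ] V →L[ℝ] ℝ)
    (hΛ : ∀ y ∈ (extChartAt I x).target, ∀ u : V, θ ((extChartAt I x).symm y)
      (mfderivWithin 𝓘(ℝ, V) I (extChartAt I x).symm (range I) y u) = Λ y u) (u v : V) :
    oneFormExtDeriv I θ x u v = Λ u v - Λ v u := by
  let Θ : V → V →L[ℝ] ℝ := fun y => (θ ((extChartAt I x).symm y)).comp
      (mfderivWithin 𝓘(ℝ, V) I (extChartAt I x).symm (range I) y)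
  have hev : Θ =ᶠ[𝓝 (extChartAt I x x)] Λ := by
    have := extChartAt_target_mem_nhdsWithin (I := I) x
    rw [hI, nhdsWithin_univ] at this
    filter_upwards [this] with y hy
    exact ContinuousLinearMap.ext fun u => hΛ y hy u
  have hD : fderivWithin ℝ Θ (range I) (extChartAt I x x) = Λ := by
    rw [hI, fderivWithin_univ, hev.fderiv_eq]; exact Λ.fderiv
  let A : V →L[ℝ] V := mfderiv I 𝓘(ℝ, V) (extChartAt I x) x
  have hA : A = .id ℝ V := by
    have h := TangentBundle.continuousLinearMapAt_trivializationAt (𝕜 := ℝ)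
      (I := I) (x₀ := x) (x := x) (mem_chart_source _ x)
    refine h.symm.trans ?_
    rw [TangentBundle.continuousLinearMapAt_trivializationAt_eq_core (mem_chart_source _ x)]
    refine ContinuousLinearMap.ext fun u => ?_
    exact (tangentBundleCore I M).coordChange_self
      (achart _ x) x (mem_chart_source _ x) u
  change fderivWithin ℝ Θ (range I) (extChartAt I x x) (A u) (A v) -
    fderivWithin ℝ Θ (range I) (extChartAt I x x) (A v) (A u) = _
  rw [hD, hA]
  rfl

/-- `ω = dq ∧ dp` in natural coordinates. -/
theorem symplecticForm_apply (a : CotangentBundle 𝓘(ℝ, E) Q) (u v : E × (E →L[ℝ] ℝ)) :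
    symplecticForm 𝓘(ℝ, E) a u v = v.2 u.1 - u.2 v.1 := by
  let Λ : (E × (E →L[ℝ] ℝ)) →L[ℝ] (E × (E →L[ℝ] ℝ)) →L[ℝ] ℝ :=
    ((ContinuousLinearMap.compL ℝ (E × (E →L[ℝ] ℝ)) E ℝ).flip (.fst ℝ E (E →L[ℝ] ℝ))).comp
      (.snd ℝ E (E →L[ℝ] ℝ))
  have h := oneFormExtDeriv_apply_of_eventually 𝓘(ℝ, E).cotangent (by simp)
    (liouvilleForm 𝓘(ℝ, E)) a Λ (fun y hy u => liouvilleForm_chart a y hy u) u v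
  change -(oneFormExtDeriv 𝓘(ℝ, E).cotangent (liouvilleForm 𝓘(ℝ, E)) a u v) = _
  rw [h]
  change -(u.2 v.1 - v.2 u.1) = _
  ring

theorem bilinear_isInvertible {V : Type*} [NormedAddCommGroup V] [NormedSpace ℝ V]
    [FiniteDimensional ℝ V] (B : V →L[ℝ] V →L[ℝ] ℝ) (hinj : Function.Injective B) :
    B.IsInvertible := by
  have hfin : Module.finrank ℝ V = Module.finrank ℝ (V →L[ℝ] ℝ) := by
    rw [(LinearMap.toContinuousLinearMap (𝕜 := ℝ) (E := V) (F' := ℝ)).finrank_eq.symm]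
    exact (Subspace.dual_finrank_eq (K := ℝ) (V := V)).symm
  exact ⟨(LinearEquiv.ofInjectiveOfFinrankEq B.toLinearMap hinj hfin).toContinuousLinearEquiv, rfl⟩

set_option synthInstance.maxHeartbeats 400000 in
theorem symplecticForm_isInvertible [FiniteDimensional ℝ E] (a : CotangentBundle 𝓘(ℝ, E) Q) :
    (symplecticForm 𝓘(ℝ, E) a).IsInvertible := by
  let B : (E × (E →L[ℝ] ℝ)) →L[ℝ] (E × (E →L[ℝ] ℝ)) →L[ℝ] ℝ := symplecticForm 𝓘(ℝ, E) a
  have hB : ∀ u v, B u v = v.2 u.1 - u.2 v.1 := symplecticForm_apply a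
  have hinj : Function.Injective B := by
    rw [injective_iff_map_eq_zero]
    intro u hu
    have h : ∀ v : E × (E →L[ℝ] ℝ), v.2 u.1 - u.2 v.1 = 0 := fun v => by rw [← hB, hu]; rfl
    have h1 : u.1 = 0 := by
      by_contra hne
      obtain ⟨g, hg⟩ := SeparatingDual.exists_ne_zero (R := ℝ) hne
      exact hg (by simpa using h (0, g))
    have h2 : u.2 = 0 := by
      ext x; simpa using h (x, 0)
    exact Prod.ext h1 h2
  exact bilinear_isInvertible B hinj

/-- The Hamiltonian vector field satisfies `i_{X_H} ω = dH`. -/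
theorem hamiltonianVectorField_spec [FiniteDimensional ℝ E] (Ham : CotangentBundle 𝓘(ℝ, E) Q → ℝ)
    (a : CotangentBundle 𝓘(ℝ, E) Q) :
    symplecticForm 𝓘(ℝ, E) a (hamiltonianVectorField 𝓘(ℝ, E) Ham a) =
      mfderiv 𝓘(ℝ, E).cotangent 𝓘(ℝ, ℝ) Ham a :=
  (((symplecticForm_isInvertible a).inverse_apply_eq).1 rfl).symm

end SymplecticForm

section Lift

variable {E : Type*} [NormedAddCommGroup E] [NormedSpace ℝ E]
  {H : Type*} [TopologicalSpace H] (I : ModelWithCorners ℝ E H)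
  {M : Type*} [TopologicalSpace M] [ChartedSpace H M] [IsManifold I 1 M]

/-- The canonical isomorphism `α_M : TT^*M → T^*TM`, in natural coordinates
`(q, p, q̇, ṗ) ↦ (q, q̇, ṗ, p)`: the image of a vector with components `(q̇, ṗ)` at the covector `p_q` is
the covector `(δq, δv) ↦ ṗ δq + p δv` at the vector `q̇` of `T_q M`. Mathlib expresses a tangent
vector to `M`, `TM` or `T^*M` at a point over `q` in the natural coordinates induced by the preferred
chart of `M` at `q`; these are the coordinates used here on all spaces. -/
def tulczyjew (w : TangentBundle I.cotangent (CotangentBundle I M)) :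
    CotangentBundle I.tangent (TangentBundle I M) :=
  let q : M := w.proj.proj
  let p : E →L[ℝ] ℝ := w.proj.snd
  let w' : E × (E →L[ℝ] ℝ) := w.snd
  ⟨⟨q, w'.1⟩, (w'.2.coprod p : E × E →L[ℝ] ℝ)⟩

/-- The diffeomorphism `Φ : T^*M × T^*M → T^*(M × M)`, `(q₀, p₀; q₁, p₁) ↦ (q₀, q₁, -p₀, p₁)`. -/
def cotangentProdEquiv :
    CotangentBundle I M × CotangentBundle I M ≃ CotangentBundle (I.prod I) (M × M) where
  toFun a := ⟨(a.1.proj, a.2.proj),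
    ((-(a.1.snd : E →L[ℝ] ℝ)).coprod (a.2.snd : E →L[ℝ] ℝ) : E × E →L[ℝ] ℝ)⟩
  invFun b :=
    (⟨b.proj.1, -((b.snd : E × E →L[ℝ] ℝ).comp (ContinuousLinearMap.inl ℝ E E))⟩,
      ⟨b.proj.2, (b.snd : E × E →L[ℝ] ℝ).comp (ContinuousLinearMap.inr ℝ E E)⟩)
  left_inv := by
    rintro ⟨⟨q, p⟩, ⟨q', p'⟩⟩
    have h₁ : ∀ a b : E →L[ℝ] ℝ, -(((-a).coprod b).comp (.inl ℝ E E)) = a := by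
      intro a b; ext; simp
    have h₂ : ∀ a b : E →L[ℝ] ℝ, ((-a).coprod b).comp (.inr ℝ E E) = b := by
      intro a b; ext; simp
    exact Prod.ext (congrArg (TotalSpace.mk q) (h₁ p p')) (congrArg (TotalSpace.mk q') (h₂ p p'))
  right_inv := by
    rintro ⟨⟨q, q'⟩, p⟩
    have h : ∀ c : E × E →L[ℝ] ℝ,
        (-(-(c.comp (.inl ℝ E E)))).coprod (c.comp (.inr ℝ E E)) = c := by
      intro c; ext <;> simp
    exact congrArg (TotalSpace.mk (q, q')) (h p)

/-- The cotangent lift `R^{T^*} = Φ⁻¹ ∘ R̂ ∘ α_M : TT^*M → T^*M × T^*M` of `R : TM → M × M`. -/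
def discretizationCotangentLift (R : TangentBundle I M → M × M)
    (w : TangentBundle I.cotangent (CotangentBundle I M)) :
    CotangentBundle I M × CotangentBundle I M :=
  (cotangentProdEquiv I).symm (cotangentLift I.tangent (I.prod I) R (tulczyjew I w))

/-- The domain of `R^{T^*}` for `R : U ⊆ TM → M × M`: the vectors `w` lying over a vector of `U` at
which `R` is a local diffeomorphism, that is, where its tangent map is invertible. -/
def discretizationCotangentLiftDomain (U : Set (TangentBundle I M))
    (R : TangentBundle I M → M × M) :
    Set (TangentBundle I.cotangent (CotangentBundle I M)) :=
  {w | (tulczyjew I w).proj ∈ U ∧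
    (mfderiv I.tangent (I.prod I) R (tulczyjew I w).proj).IsInvertible}

/-- `L^h`, the set of pairs `(α, β)` such that `(α, β) = R^{T^*} (h X_H(γ))` for some `γ ∈ T^*M` with
`h X_H(γ)` in the domain of `R^{T^*}`. -/
def integratorRelation (U : Set (TangentBundle I M)) (R : TangentBundle I M → M × M)
    (Ham : CotangentBundle I M → ℝ) (h : ℝ) :
    Set (CotangentBundle I M × CotangentBundle I M) :=
  {ab | ∃ γ : CotangentBundle I M,
    TangentBundle.smulFiber _ h ⟨γ, hamiltonianVectorField I Ham γ⟩
        ∈ discretizationCotangentLiftDomain I U R ∧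
      ab = discretizationCotangentLift I R
        (TangentBundle.smulFiber _ h ⟨γ, hamiltonianVectorField I Ham γ⟩)}

/-- The transpose `L^† = {(α, β) | (β, α) ∈ L}`. -/
def relationTranspose {X : Type*} (L : Set (X × X)) : Set (X × X) :=
  {ab | (ab.2, ab.1) ∈ L}

end Lift

end

/-!
Covector negation commutes with cotangent lifts, and up to this negation both identifications in
`R^{T^*} = Φ⁻¹ ∘ R̂ ∘ α` are equivariant: writing `n` for fibrewise negation on the tangent bundle,
`α (-w) = -n̂ (α w)` and `Φ (b, a) = -ι̂ (Φ (a, b))`. The cotangent lift being functorial,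
`R ∘ n = ι ∘ R` gives `R̂ ∘ n̂ = ι̂ ∘ R̂`, the two signs cancel, and `R^{T^*} (-w)` is `R^{T^*} w` with
its components exchanged.
-/

section FiberwiseScaling

variable {𝕜 : Type*} [NontriviallyNormedField 𝕜]
  {E : Type*} [NormedAddCommGroup E] [NormedSpace 𝕜 E]
  {H : Type*} [TopologicalSpace H] {I : ModelWithCorners 𝕜 E H}
  {B : Type*} [TopologicalSpace B] [ChartedSpace H B]
  {F : Type*} [NormedAddCommGroup F] [NormedSpace 𝕜 F]
  {V : B → Type*} [∀ x, AddCommGroup (V x)] [∀ x, Module 𝕜 (V x)] [∀ x, TopologicalSpace (V x)]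
  [TopologicalSpace (TotalSpace F V)] [FiberBundle F V] [VectorBundle 𝕜 F V]

theorem trivializationAt_smul_snd (c : 𝕜) {x : B} {v : TotalSpace F V}
    (hv : v.proj ∈ (trivializationAt F V x).baseSet) :
    (trivializationAt F V x ⟨v.proj, c • v.snd⟩).2 = c • (trivializationAt F V x v).2 :=
  ((trivializationAt F V x).linear 𝕜 hv).map_smul c v.snd

variable (F V) in
theorem continuous_totalSpace_smul (c : 𝕜) :
    Continuous (fun v : TotalSpace F V ↦ (⟨v.proj, c • v.snd⟩ : TotalSpace F V)) := by
  refine continuous_iff_continuousAt.2 fun v ↦ (FiberBundle.continuousAt_totalSpace F _).2 ?_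
  have hproj : ContinuousAt (TotalSpace.proj : TotalSpace F V → B) v :=
    (FiberBundle.continuous_proj F V).continuousAt
  have hsnd : ContinuousAt (fun w ↦ c • (trivializationAt F V v.proj w).2) v :=
    ((FiberBundle.continuousAt_totalSpace F id).1 continuousAt_id).2.const_smul c
  have hbase : ∀ᶠ w in 𝓝 v, w.proj ∈ (trivializationAt F V v.proj).baseSet :=
    hproj.eventually ((trivializationAt F V v.proj).open_baseSet.mem_nhds
      (mem_baseSet_trivializationAt F V v.proj))
  exact ⟨hproj, hsnd.congr (hbase.mono fun w hw ↦ (trivializationAt_smul_snd c hw).symm)⟩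

variable (I) in
theorem extChartAt_totalSpace_smul (c : 𝕜) {v w : TotalSpace F V}
    (hw : w ∈ (extChartAt (I.prod 𝓘(𝕜, F)) v).source) :
    extChartAt (I.prod 𝓘(𝕜, F)) (⟨v.proj, c • v.snd⟩ : TotalSpace F V) ⟨w.proj, c • w.snd⟩ =
      Prod.map id (c • ·) (extChartAt (I.prod 𝓘(𝕜, F)) v w) := by
  rw [extChartAt_source, FiberBundle.chartedSpace_chartAt] at hw
  have hbase : w.proj ∈ (trivializationAt F V v.proj).baseSet :=
    (trivializationAt F V v.proj).mem_source.1 hw.1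
  have hfst : (trivializationAt F V v.proj ⟨w.proj, c • w.snd⟩).1 =
      (trivializationAt F V v.proj w).1 := by
    rw [(trivializationAt F V v.proj).coe_fst' hbase]
    exact (trivializationAt F V v.proj).coe_fst' hbase
  rw [FiberBundle.extChartAt, FiberBundle.extChartAt]
  exact Prod.ext (congrArg (extChartAt I v.proj) hfst) (trivializationAt_smul_snd c hbase)

variable (I) in
theorem hasMFDerivAt_totalSpace_smul (c : 𝕜) (v : TotalSpace F V) :
    HasMFDerivAt (I.prod 𝓘(𝕜, F)) (I.prod 𝓘(𝕜, F))
      (fun w : TotalSpace F V ↦ (⟨w.proj, c • w.snd⟩ : TotalSpace F V)) v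
      ((ContinuousLinearMap.id 𝕜 E).prodMap (c • ContinuousLinearMap.id 𝕜 F) :
        E × F →L[𝕜] E × F) := by
  refine ⟨(continuous_totalSpace_smul F V c).continuousAt, ?_⟩
  let L : E × F →L[𝕜] E × F :=
    (ContinuousLinearMap.id 𝕜 E).prodMap (c • ContinuousLinearMap.id 𝕜 F)
  have hcoord : ∀ y ∈ (extChartAt (I.prod 𝓘(𝕜, F)) v).target,
      writtenInExtChartAt (I.prod 𝓘(𝕜, F)) (I.prod 𝓘(𝕜, F)) v
        (fun w : TotalSpace F V ↦ (⟨w.proj, c • w.snd⟩ : TotalSpace F V)) y = L y := by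
    intro y hy
    have h := extChartAt_totalSpace_smul I c ((extChartAt (I.prod 𝓘(𝕜, F)) v).map_target hy)
    rw [(extChartAt (I.prod 𝓘(𝕜, F)) v).right_inv hy] at h
    exact h
  refine L.hasFDerivAt.hasFDerivWithinAt.congr_of_eventuallyEq ?_
    (hcoord _ (mem_extChartAt_target v))
  filter_upwards [extChartAt_target_mem_nhdsWithin (I := I.prod 𝓘(𝕜, F)) v] with y hy
    using hcoord y hy

end FiberwiseScaling

section ProductSwap

variable {𝕜 : Type*} [NontriviallyNormedField 𝕜]
  {E : Type*} [NormedAddCommGroup E] [NormedSpace 𝕜 E]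
  {H : Type*} [TopologicalSpace H] {I : ModelWithCorners 𝕜 E H}
  {M : Type*} [TopologicalSpace M] [ChartedSpace H M]
  {E' : Type*} [NormedAddCommGroup E'] [NormedSpace 𝕜 E']
  {H' : Type*} [TopologicalSpace H'] {I' : ModelWithCorners 𝕜 E' H'}
  {N : Type*} [TopologicalSpace N] [ChartedSpace H' N]

theorem hasMFDerivAt_prodSwap (z : M × N) :
    HasMFDerivAt (I.prod I') (I'.prod I) (Prod.swap : M × N → N × M) z
      (ContinuousLinearEquiv.prodComm 𝕜 E E' : E × E' →L[𝕜] E' × E) :=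
  (hasMFDerivAt_snd z).prodMk (hasMFDerivAt_fst z)

end ProductSwap

section CotangentLift

variable {E : Type*} [NormedAddCommGroup E] [NormedSpace ℝ E]
  {H : Type*} [TopologicalSpace H] {I : ModelWithCorners ℝ E H}
  {M : Type*} [TopologicalSpace M] [ChartedSpace H M]
  {E' : Type*} [NormedAddCommGroup E'] [NormedSpace ℝ E']
  {H' : Type*} [TopologicalSpace H'] {I' : ModelWithCorners ℝ E' H'}
  {N : Type*} [TopologicalSpace N] [ChartedSpace H' N]
  {E'' : Type*} [NormedAddCommGroup E''] [NormedSpace ℝ E'']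
  {H'' : Type*} [TopologicalSpace H''] {I'' : ModelWithCorners ℝ E'' H''}
  {P : Type*} [TopologicalSpace P] [ChartedSpace H'' P]

/-- Fibrewise negation in a cotangent bundle, `α_x ↦ -α_x`. -/
noncomputable def CotangentBundle.negFiber (a : CotangentBundle I M) : CotangentBundle I M :=
  ⟨a.proj, -a.snd⟩

theorem cotangentLift_negFiber (F : M → N) (a : CotangentBundle I M) :
    cotangentLift I I' F a.negFiber = (cotangentLift I I' F a).negFiber :=
  congrArg (TotalSpace.mk (F a.proj)) (ContinuousLinearMap.neg_comp _ _)

theorem cotangentLift_congr {F G : M → N} {a : CotangentBundle I M} (h : F =ᶠ[𝓝 a.proj] G) :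
    cotangentLift I I' F a = cotangentLift I I' G a := by
  let A : E →L[ℝ] E' := mfderiv I I' F a.proj
  let B : E →L[ℝ] E' := mfderiv I I' G a.proj
  have hAB : A = B := h.mfderiv_eq
  exact congrArg₂ (fun (y : N) (T : E →L[ℝ] E') ↦
    (⟨y, (a.snd : E →L[ℝ] ℝ).comp T.inverse⟩ : CotangentBundle I' N)) h.eq_of_nhds hAB

theorem cotangentLift_eq_of_hasMFDerivAt {F : M → N} {a : CotangentBundle I M} {e : E ≃L[ℝ] E'}
    (hF : HasMFDerivAt I I' F a.proj (e : E →L[ℝ] E')) :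
    cotangentLift I I' F a = ⟨F a.proj, (a.snd : E →L[ℝ] ℝ).comp (e.symm : E' →L[ℝ] E)⟩ := by
  unfold cotangentLift
  rw [hF.mfderiv]
  exact congrArg (fun f : E' →L[ℝ] E ↦
    (⟨F a.proj, (a.snd : E →L[ℝ] ℝ).comp f⟩ : CotangentBundle I' N))
    (ContinuousLinearMap.inverse_equiv e)

theorem cotangentLift_comp_of_left {G : N → P} {F : M → N} {a : CotangentBundle I M}
    (hG : MDifferentiableAt I' I'' G (F a.proj)) (hF : MDifferentiableAt I I' F a.proj)
    (hinv : (mfderiv I' I'' G (F a.proj)).IsInvertible) :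
    cotangentLift I I'' (G ∘ F) a = cotangentLift I' I'' G (cotangentLift I I' F a) := by
  refine congrArg (TotalSpace.mk (G (F a.proj))) ?_
  rw [mfderiv_comp a.proj hG hF]
  exact congrArg (a.snd.comp ·) hinv.inverse_comp_of_left

theorem cotangentLift_comp_of_right {G : N → P} {F : M → N} {a : CotangentBundle I M}
    (hG : MDifferentiableAt I' I'' G (F a.proj)) (hF : MDifferentiableAt I I' F a.proj)
    (hinv : (mfderiv I I' F a.proj).IsInvertible) :
    cotangentLift I I'' (G ∘ F) a = cotangentLift I' I'' G (cotangentLift I I' F a) := by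
  refine congrArg (TotalSpace.mk (G (F a.proj))) ?_
  rw [mfderiv_comp a.proj hG hF]
  exact congrArg (a.snd.comp ·) hinv.inverse_comp_of_right

end CotangentLift

section SymmetricLift

variable {E : Type*} [NormedAddCommGroup E] [NormedSpace ℝ E]
  {H : Type*} [TopologicalSpace H] {I : ModelWithCorners ℝ E H}
  {M : Type*} [TopologicalSpace M] [ChartedSpace H M]

theorem smulFiber_neg (c : ℝ) (v : TangentBundle I M) :
    TangentBundle.smulFiber I (-c) v = TangentBundle.negFiber I (TangentBundle.smulFiber I c v) :=
  congrArg (TotalSpace.mk v.proj) (neg_smul c v.snd)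

theorem cotangentProdEquiv_swap (a : CotangentBundle I M × CotangentBundle I M) :
    cotangentProdEquiv I a.swap =
      (cotangentLift (I.prod I) (I.prod I) Prod.swap (cotangentProdEquiv I a)).negFiber := by
  rw [cotangentLift_eq_of_hasMFDerivAt (hasMFDerivAt_prodSwap (cotangentProdEquiv I a).proj)]
  have hcov (p₀ p₁ : E →L[ℝ] ℝ) : (-p₁).coprod p₀ = -(((-p₀).coprod p₁).comp
      ((ContinuousLinearEquiv.prodComm ℝ E E).symm : E × E →L[ℝ] E × E)) := by
    ext <;> simp
  exact congrArg (TotalSpace.mk _) (hcov a.1.snd a.2.snd)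

variable [IsManifold I 1 M]

theorem hasMFDerivAt_negFiber (v : TangentBundle I M) :
    HasMFDerivAt I.tangent I.tangent (TangentBundle.negFiber I) v
      ((ContinuousLinearEquiv.refl ℝ E).prodCongr (ContinuousLinearEquiv.neg ℝ (M := E)) :
        E × E →L[ℝ] E × E) := by
  have hfun : TangentBundle.negFiber I =
      fun w : TangentBundle I M ↦ (⟨w.proj, (-1 : ℝ) • w.snd⟩ : TangentBundle I M) :=
    funext fun w ↦ congrArg (TotalSpace.mk w.proj) (neg_one_smul ℝ w.snd).symm
  have hderiv : ((ContinuousLinearEquiv.refl ℝ E).prodCongr (ContinuousLinearEquiv.neg ℝ (M := E)) :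
      E × E →L[ℝ] E × E) =
        (ContinuousLinearMap.id ℝ E).prodMap ((-1 : ℝ) • ContinuousLinearMap.id ℝ E) := by
    ext <;> simp
  rw [hfun, hderiv]
  exact hasMFDerivAt_totalSpace_smul I (-1 : ℝ) v

theorem tulczyjew_negFiber (w : TangentBundle I.cotangent (CotangentBundle I M)) :
    tulczyjew I (TangentBundle.negFiber I.cotangent w) =
      (cotangentLift I.tangent I.tangent (TangentBundle.negFiber I)
        (tulczyjew I w)).negFiber := by
  rw [cotangentLift_eq_of_hasMFDerivAt (hasMFDerivAt_negFiber (tulczyjew I w).proj)]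
  have hcov (p p' : E →L[ℝ] ℝ) : (-p').coprod p = -((p'.coprod p).comp
      (((ContinuousLinearEquiv.refl ℝ E).prodCongr (ContinuousLinearEquiv.neg ℝ (M := E))).symm :
        E × E →L[ℝ] E × E)) := by
    ext <;> simp
  exact congrArg (TotalSpace.mk _) (hcov w.proj.snd (Prod.snd (α := E) w.snd))

variable {R : TangentBundle I M → M × M}

theorem isInvertible_mfderiv_negFiber {v : TangentBundle I M}
    (hsymm : R ∘ TangentBundle.negFiber I =ᶠ[𝓝 v] Prod.swap ∘ R)
    (hv : MDifferentiableAt I.tangent (I.prod I) R v)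
    (hnv : MDifferentiableAt I.tangent (I.prod I) R (TangentBundle.negFiber I v))
    (hinv : (mfderiv I.tangent (I.prod I) R v).IsInvertible) :
    (mfderiv I.tangent (I.prod I) R (TangentBundle.negFiber I v)).IsInvertible := by
  have hcomp := hnv.hasMFDerivAt.comp v (hasMFDerivAt_negFiber v)
  have hswap := (hasMFDerivAt_prodSwap (I := I) (I' := I) (R v)).comp v hv.hasMFDerivAt
  have hchain := hasMFDerivAt_unique hcomp (hswap.congr_of_eventuallyEq hsymm)
  exact ContinuousLinearMap.isInvertible_comp_equiv.1
    (hchain ▸ ContinuousLinearMap.isInvertible_equiv_comp.2 hinv)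

theorem discretizationCotangentLift_negFiber
    {w : TangentBundle I.cotangent (CotangentBundle I M)}
    (hsymm : R ∘ TangentBundle.negFiber I =ᶠ[𝓝 (tulczyjew I w).proj] Prod.swap ∘ R)
    (hw : MDifferentiableAt I.tangent (I.prod I) R (tulczyjew I w).proj)
    (hnw : MDifferentiableAt I.tangent (I.prod I) R
      (TangentBundle.negFiber I (tulczyjew I w).proj)) :
    discretizationCotangentLift I R (TangentBundle.negFiber I.cotangent w) =
      (discretizationCotangentLift I R w).swap := by
  have hneg := hasMFDerivAt_negFiber (tulczyjew I w).proj
  have hswap := hasMFDerivAt_prodSwap (I := I) (I' := I) (R (tulczyjew I w).proj)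
  have hnat : cotangentLift I.tangent (I.prod I) R
        (cotangentLift I.tangent I.tangent (TangentBundle.negFiber I) (tulczyjew I w)) =
      cotangentLift (I.prod I) (I.prod I) Prod.swap
        (cotangentLift I.tangent (I.prod I) R (tulczyjew I w)) := by
    rw [← cotangentLift_comp_of_right hnw hneg.mdifferentiableAt
        (hneg.mfderiv ▸ ContinuousLinearMap.isInvertible_equiv),
      ← cotangentLift_comp_of_left hswap.mdifferentiableAt hw
        (hswap.mfderiv ▸ ContinuousLinearMap.isInvertible_equiv),
      cotangentLift_congr hsymm]
  refine (Equiv.symm_apply_eq _).2 ?_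
  rw [cotangentProdEquiv_swap, discretizationCotangentLift, Equiv.apply_symm_apply,
    tulczyjew_negFiber, cotangentLift_negFiber, hnat]

/-- The relation `{R^{T^*}(h X(γ)) | γ ∈ T^*M, h X(γ) ∈ dom R^{T^*}}` of an arbitrary vector field
`X` on `T^*M`, of which `integratorRelation` is the case `X = X_H`. -/
noncomputable def vectorFieldIntegratorRelation (U : Set (TangentBundle I M))
    (R : TangentBundle I M → M × M)
    (X : ∀ γ : CotangentBundle I M, TangentSpace I.cotangent γ) (h : ℝ) :
    Set (CotangentBundle I M × CotangentBundle I M) :=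
  {ab | ∃ γ : CotangentBundle I M,
    TangentBundle.smulFiber _ h ⟨γ, X γ⟩ ∈ discretizationCotangentLiftDomain I U R ∧
      ab = discretizationCotangentLift I R (TangentBundle.smulFiber _ h ⟨γ, X γ⟩)}

theorem swap_mem_vectorFieldIntegratorRelation_neg {U : Set (TangentBundle I M)} (hU : IsOpen U)
    (hR : MDifferentiableOn I.tangent (I.prod I) R U)
    (hsymm : ∀ v ∈ U, TangentBundle.negFiber I v ∈ U ∧
      R v = Prod.swap (R (TangentBundle.negFiber I v)))
    {X : ∀ γ : CotangentBundle I M, TangentSpace I.cotangent γ} {h : ℝ}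
    {z : CotangentBundle I M × CotangentBundle I M}
    (hz : z ∈ vectorFieldIntegratorRelation U R X h) :
    z.swap ∈ vectorFieldIntegratorRelation U R X (-h) := by
  obtain ⟨γ, ⟨hmem, hinv⟩, rfl⟩ := hz
  have hdiff {v : TangentBundle I M} (hv : v ∈ U) : MDifferentiableAt I.tangent (I.prod I) R v :=
    hR.mdifferentiableAt (hU.mem_nhds hv)
  have hloc {v : TangentBundle I M} (hv : v ∈ U) :
      R ∘ TangentBundle.negFiber I =ᶠ[𝓝 v] Prod.swap ∘ R := by
    filter_upwards [hU.mem_nhds hv] with u hu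
    exact (congrArg Prod.swap (hsymm u hu).2).symm
  have hnmem := (hsymm _ hmem).1
  refine ⟨γ, ?_, ?_⟩ <;> rw [smulFiber_neg]
  · exact ⟨hnmem, isInvertible_mfderiv_negFiber (hloc hmem) (hdiff hmem) (hdiff hnmem) hinv⟩
  · exact (discretizationCotangentLift_negFiber (hloc hmem) (hdiff hmem) (hdiff hnmem)).symm

end SymmetricLift

theorem mainTheorem10_general
    {E : Type*} [NormedAddCommGroup E] [NormedSpace ℝ E]
    {H : Type*} [TopologicalSpace H] {I : ModelWithCorners ℝ E H}
    {M : Type*} [TopologicalSpace M] [ChartedSpace H M] [IsManifold I 1 M]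
    {U : Set (TangentBundle I M)} {R : TangentBundle I M → M × M} (hU : IsOpen U)
    (hR : MDifferentiableOn I.tangent (I.prod I) R U)
    (hsymm : ∀ v ∈ U, TangentBundle.negFiber I v ∈ U ∧
      R v = Prod.swap (R (TangentBundle.negFiber I v)))
    (X : ∀ γ : CotangentBundle I M, TangentSpace I.cotangent γ) (h : ℝ) :
    relationTranspose (vectorFieldIntegratorRelation U R X h) =
      vectorFieldIntegratorRelation U R X (-h) := by
  refine Subset.antisymm
    (fun z hz ↦ swap_mem_vectorFieldIntegratorRelation_neg hU hR hsymm hz) fun z hz ↦ ?_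
  have hswap := swap_mem_vectorFieldIntegratorRelation_neg hU hR hsymm hz
  rwa [neg_neg] at hswap

theorem mainTheorem10
    {E : Type*} [NormedAddCommGroup E] [NormedSpace ℝ E] [FiniteDimensional ℝ E]
    {Q : Type*} [TopologicalSpace Q] [ChartedSpace E Q] [IsManifold 𝓘(ℝ, E) ∞ Q]
    (U : Set (TangentBundle 𝓘(ℝ, E) Q)) (R : TangentBundle 𝓘(ℝ, E) Q → Q × Q)
    (hR : IsDiscretizationMap 𝓘(ℝ, E) U R)
    (hsymm : ∀ v ∈ U, TangentBundle.negFiber 𝓘(ℝ, E) v ∈ U ∧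
      R v = Prod.swap (R (TangentBundle.negFiber 𝓘(ℝ, E) v)))
    (Ham : CotangentBundle 𝓘(ℝ, E) Q → ℝ)
    (hHam : ContMDiff 𝓘(ℝ, E).cotangent 𝓘(ℝ, ℝ) ∞ Ham)
    (h : ℝ) :
    relationTranspose (integratorRelation 𝓘(ℝ, E) U R Ham h) =
      integratorRelation 𝓘(ℝ, E) U R Ham (-h) :=
  mainTheorem10_general hR.isOpen (hR.contMDiffOn.mdifferentiableOn (by simp)) hsymm
    (hamiltonianVectorField 𝓘(ℝ, E) Ham) h
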